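/- Let $k\ge 2$ and $n\ge 1$ be integers. An edge-coloring of the complete graph $K_N$ is called a $(K_3,\varphi_3;k)$-coloring if exactly $k$ colors occur on the edges of $K_N$ and there is neither a monochromatic triangle nor a rainbow triangle (a triangle whose three edges have pairwise distinct colors). It is called a $(K_3,C_{2n+1},\varphi_3;k)$-coloring if, in addition, there is no monochromatic cycle of length $2n+1$. Let $R(K_3,\varphi_3;k)$ (respectively $M_k(C_{2n+1})$) denote the minimum integer $N\ge 1$ such that $K_N$ has no $(K_3,\varphi_3;k)$-coloring (respectively, no $(K_3,C_{2n+1},\varphi_3;k)$-coloring) while $K_{N-1}$ has one. 1. If $k$ is odd and $n>\dfrac{5^{(k-1)/2}-1}{2}$, then both numbers exist and $M_k(C_{2n+1})=R(K_3,\varphi_3;k)$. 2. If $k$ is even and $n>\dfrac{5^{k/2}-1}{2}$, then both numbers exist and $M_k(C_{2n+1})=R(K_3,\varphi_3;k)$. -/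

import Mathlib

namespace MixedRamsey

open SimpleGraph

/-- The edge-coloring `C` of the complete graph on `V` contains a monochromatic copy of `H`:
some color class contains a (not necessarily induced) copy of `H`. -/
def HasMono {V W K : Type} (C : TopEdgeLabeling V K) (H : SimpleGraph W) : Prop :=
  ∃ c : K, H ⊑ C.labelGraph c

/-- The edge-coloring `C` contains a rainbow triangle: three vertices whose three connecting
edges have pairwise distinct colors. -/
def HasRainbowTriangle {V K : Type} (C : TopEdgeLabeling V K) : Prop :=
  ∃ (x y z : V) (hxy : x ≠ y) (hyz : y ≠ z) (hxz : x ≠ z),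
    C.get x y hxy ≠ C.get y z hyz ∧ C.get y z hyz ≠ C.get x z hxz ∧
      C.get x y hxy ≠ C.get x z hxz

/-- There are exactly `k` colors on the edges: each of the `k` colors is used. -/
def UsesAllColors {V : Type} {k : ℕ} (C : TopEdgeLabeling V (Fin k)) : Prop :=
  ∀ c : Fin k, ∃ e, C e = c

/-- `K_N` has a `(K_3, φ_3; k)`-coloring: an edge-coloring with exactly `k` colors and without a
monochromatic or rainbow triangle. -/
def MixedColorable (k N : ℕ) : Prop :=
  ∃ C : TopEdgeLabeling (Fin N) (Fin k), UsesAllColors C ∧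
    ¬ HasMono C (completeGraph (Fin 3)) ∧ ¬ HasRainbowTriangle C

/-- `K_N` has a `(K_3, H, φ_3; k)`-coloring, where `H` stands for the monochromatic graph `H`:
an edge-coloring with exactly `k` colors and without a monochromatic triangle, a monochromatic
copy of `H`, or a rainbow triangle. -/
def MixedPatternColorable {W : Type} (H : SimpleGraph W) (k N : ℕ) : Prop :=
  ∃ C : TopEdgeLabeling (Fin N) (Fin k), UsesAllColors C ∧
    ¬ HasMono C (completeGraph (Fin 3)) ∧ ¬ HasMono C H ∧ ¬ HasRainbowTriangle C

/-- The orders `N ≥ 1` such that `K_N` has no `(K_3, φ_3; k)`-coloring but `K_{N-1}` has one. -/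
def mixedSet (k : ℕ) : Set ℕ :=
  {N | 1 ≤ N ∧ ¬ MixedColorable k N ∧ MixedColorable k (N - 1)}

/-- The orders `N ≥ 1` such that `K_N` has no `(K_3, H, φ_3; k)`-coloring but `K_{N-1}` has
one. -/
def mixedPatternSet {W : Type} (H : SimpleGraph W) (k : ℕ) : Set ℕ :=
  {N | 1 ≤ N ∧ ¬ MixedPatternColorable H k N ∧ MixedPatternColorable H k (N - 1)}

/-- The mixed Ramsey number `R(K_3, φ_3; k)` (meaningful when `mixedSet k` is nonempty). -/
noncomputable def R (k : ℕ) : ℕ := sInf (mixedSet k)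

/-- The mixed pattern Ramsey number `M_k(H) = R(K_3, H, φ_3; k)` of the monochromatic graph `H`
(meaningful when `mixedPatternSet H k` is nonempty). -/
noncomputable def M {W : Type} (k : ℕ) (H : SimpleGraph W) : ℕ := sInf (mixedPatternSet H k)

end MixedRamsey

/-!
By Gallai's theorem, the vertices of a coloring without rainbow triangles split into at least two
classes, with one color between any two classes and at most two colors between classes altogether.
Without monochromatic triangles, either one color joins some class to the rest of the graph, or
there are at most five classes, since `R(3, 3) = 6`. A color that joins a set to some vertex is
missing inside that set, so induction on the number of colors bounds the order by `5 ^ (k / 2)` for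
even `k` and by `2 * 5 ^ ((k - 1) / 2)` for odd `k`.

Both bounds are attained by substituting colored pentagons into one another, and for odd `k`
substituting the result for the vertices of `K_2`. In these colorings, all color classes but the
bipartite one that comes from `K_2` live on blocks of `5 ^ (k / 2)` vertices, hence contain no
connected non-bipartite graph with more vertices than that. So forbidding such a graph does not
change the largest order.
-/

namespace MixedRamsey

open SimpleGraph

variable {V W K L : Type} {C : TopEdgeLabeling V K} {D : TopEdgeLabeling W L}

theorem exists_labelGraph_adj (C : TopEdgeLabeling V K) {x y : V} (h : x ≠ y) :
    ∃ a, (C.labelGraph a).Adj x y :=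
  ⟨C.get x y h, (TopEdgeLabeling.labelGraph_adj x y).2 ⟨h, rfl⟩⟩

theorem labelGraph_adj_unique {a b : K} {x y : V} (ha : (C.labelGraph a).Adj x y)
    (hb : (C.labelGraph b).Adj x y) : a = b := by
  obtain ⟨_, rfl⟩ := (TopEdgeLabeling.labelGraph_adj x y).1 ha
  obtain ⟨_, rfl⟩ := (TopEdgeLabeling.labelGraph_adj x y).1 hb
  rfl

theorem labelGraph_pullback (C : TopEdgeLabeling V K) (f : W ↪ V) (a : K) :
    (TopEdgeLabeling.pullback C f).labelGraph a = (C.labelGraph a).comap f := by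
  ext x y
  simp only [TopEdgeLabeling.labelGraph_adj, comap_adj, EdgeLabeling.get, f.injective.ne_iff]
  rfl

theorem labelGraph_compRight_equiv (C : TopEdgeLabeling V K) (e : K ≃ L) (b : L) :
    EdgeLabeling.labelGraph (C.compRight e) b = C.labelGraph (e.symm b) := by
  ext x y
  simp only [TopEdgeLabeling.labelGraph_adj, EdgeLabeling.compRight_get, Equiv.eq_symm_apply]

theorem hasMono_completeGraph_iff {n : ℕ} :
    HasMono C (completeGraph (Fin n)) ↔ ∃ a, ¬ (C.labelGraph a).CliqueFree n :=
  exists_congr fun _ => (not_cliqueFree_iff_top_isContained n).symm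

theorem hasRainbowTriangle_iff :
    HasRainbowTriangle C ↔ ∃ x y z a b c, (C.labelGraph a).Adj x y ∧ (C.labelGraph b).Adj y z ∧
      (C.labelGraph c).Adj x z ∧ a ≠ b ∧ b ≠ c ∧ a ≠ c := by
  simp only [TopEdgeLabeling.labelGraph_adj]
  constructor
  · rintro ⟨x, y, z, hxy, hyz, hxz, h⟩
    exact ⟨x, y, z, _, _, _, ⟨hxy, rfl⟩, ⟨hyz, rfl⟩, ⟨hxz, rfl⟩, h⟩
  · rintro ⟨x, y, z, _, _, _, ⟨hxy, rfl⟩, ⟨hyz, rfl⟩, ⟨hxz, rfl⟩, h⟩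
    exact ⟨x, y, z, hxy, hyz, hxz, h⟩

theorem HasMono.of_pullback {U : Type} {H : SimpleGraph U} {f : W ↪ V}
    (h : HasMono (TopEdgeLabeling.pullback C f) H) : HasMono C H := by
  obtain ⟨a, ha⟩ := h
  rw [labelGraph_pullback] at ha
  exact ⟨a, ha.trans (Embedding.comap f _).isContained⟩

theorem HasMono.of_compRight_equiv {U : Type} {H : SimpleGraph U} {e : K ≃ L}
    (h : HasMono (C.compRight e) H) : HasMono C H := by
  obtain ⟨b, hb⟩ := h
  exact ⟨e.symm b, labelGraph_compRight_equiv C e b ▸ hb⟩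

theorem HasMono.card_le {U : Type} [Fintype U] [Fintype V] {H : SimpleGraph U}
    (h : HasMono C H) : Fintype.card U ≤ Fintype.card V := by
  obtain ⟨_, ⟨φ⟩⟩ := h
  exact Fintype.card_le_of_injective φ φ.injective

theorem HasRainbowTriangle.of_pullback {f : W ↪ V}
    (h : HasRainbowTriangle (TopEdgeLabeling.pullback C f)) : HasRainbowTriangle C := by
  obtain ⟨x, y, z, hxy, hyz, hxz, h⟩ := h
  exact ⟨f x, f y, f z, f.injective.ne hxy, f.injective.ne hyz, f.injective.ne hxz, h⟩

theorem HasRainbowTriangle.of_compRight {e : K → L} (h : HasRainbowTriangle (C.compRight e)) :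
    HasRainbowTriangle C := by
  obtain ⟨x, y, z, hxy, hyz, hxz, h₁, h₂, h₃⟩ := h
  exact ⟨x, y, z, hxy, hyz, hxz, ne_of_apply_ne e h₁, ne_of_apply_ne e h₂, ne_of_apply_ne e h₃⟩

theorem not_hasRainbowTriangle_of_card_le_two [Fintype K] (hK : Fintype.card K ≤ 2) :
    ¬ HasRainbowTriangle C := by
  rintro ⟨_, _, _, _, _, _, h₁, h₂, h₃⟩
  exact hK.not_gt (Fintype.two_lt_card_iff.2 ⟨_, _, _, h₁, h₃, h₂⟩)

theorem adj_or_adj_of_not_hasRainbowTriangle (hC : ¬ HasRainbowTriangle C) {a b : K} {x y z : V}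
    (hab : a ≠ b) (hxz : x ≠ z) (hxy : (C.labelGraph a).Adj x y)
    (hyz : (C.labelGraph b).Adj y z) :
    (C.labelGraph a).Adj x z ∨ (C.labelGraph b).Adj x z := by
  obtain ⟨c, hc⟩ := exists_labelGraph_adj C hxz
  by_contra! h
  exact hC (hasRainbowTriangle_iff.2 ⟨x, y, z, a, b, c, hxy, hyz, hc, hab,
    fun e => h.2 (e ▸ hc), fun e => h.1 (e ▸ hc)⟩)

/-! ### Gallai partitions -/

theorem adj_of_reachable (hC : ¬ HasRainbowTriangle C) {a b : K} {x x' y : V}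
    (hxx' : (C.labelGraph a).Reachable x x') (hxy : ¬ (C.labelGraph a).Reachable x y)
    (h : (C.labelGraph b).Adj x y) : (C.labelGraph b).Adj x' y := by
  obtain ⟨p⟩ := hxx'
  induction p with
  | nil => exact h
  | @cons u v w huv _ ih =>
    have hvy : ¬ (C.labelGraph a).Reachable v y := fun hr => hxy (huv.reachable.trans hr)
    have hab : a ≠ b := by rintro rfl; exact hxy h.reachable
    have hne : v ≠ y := by rintro rfl; exact hxy huv.reachable
    exact ih hvy ((adj_or_adj_of_not_hasRainbowTriangle hC hab hne huv.symm h).resolve_left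
      fun hadj => hvy hadj.reachable)

theorem exists_reachable_induce_compl_singleton_adj {α : Type*} {G : SimpleGraph α}
    {x v : α} (h : G.Reachable x v) (hx : x ≠ v) :
    ∃ u : ({v}ᶜ : Set α), (G.induce {v}ᶜ).Reachable ⟨x, hx⟩ u ∧ G.Adj u v := by
  obtain ⟨p⟩ := h
  induction p with
  | nil => exact absurd rfl hx
  | @cons x y v hxy _ ih =>
    by_cases hy : y = v
    · exact ⟨⟨x, hx⟩, .refl _, hy ▸ hxy⟩
    · obtain ⟨u, hyu, hu⟩ := ih hy
      have hxy' : (G.induce {v}ᶜ).Adj ⟨x, hx⟩ ⟨y, hy⟩ := hxy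
      exact ⟨u, hxy'.reachable.trans hyu, hu⟩

/-- The restriction of an edge-coloring of the complete graph to a set of vertices. -/
abbrev restrict (C : TopEdgeLabeling V K) (s : Set V) : TopEdgeLabeling s K :=
  TopEdgeLabeling.pullback C (Function.Embedding.subtype (· ∈ s))

theorem labelGraph_restrict (C : TopEdgeLabeling V K) (s : Set V) (a : K) :
    (restrict C s).labelGraph a = (C.labelGraph a).induce s :=
  labelGraph_pullback C _ a

theorem adj_of_reachable_induce (hC : ¬ HasRainbowTriangle C) {a b : K} {s : Set V} {x x' y : s}
    (hxx' : ((C.labelGraph a).induce s).Reachable x x')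
    (hxy : ¬ ((C.labelGraph a).induce s).Reachable x y) (h : (C.labelGraph b).Adj x y) :
    (C.labelGraph b).Adj x' y := by
  rw [← labelGraph_restrict] at hxx' hxy
  have h' : ((restrict C s).labelGraph b).Adj x y := by rwa [labelGraph_restrict]
  have := adj_of_reachable (mt HasRainbowTriangle.of_pullback hC) hxx' hxy h'
  rwa [labelGraph_restrict] at this

theorem adj_of_not_reachable_induce_compl_singleton (hC : ¬ HasRainbowTriangle C) {m p : K}
    {v : V} {w y : ({v}ᶜ : Set V)} (hm : (C.labelGraph m).Preconnected) (hpm : p ≠ m)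
    (hwv : (C.labelGraph p).Adj w v)
    (hwy : ¬ ((C.labelGraph m).induce {v}ᶜ).Reachable w y) : (C.labelGraph p).Adj w y := by
  obtain ⟨u, hyu, huv⟩ := exists_reachable_induce_compl_singleton_adj (hm y v) y.2
  have hwu : ¬ ((C.labelGraph m).induce {v}ᶜ).Reachable w u := fun h => hwy (h.trans hyu.symm)
  have hne : (w : V) ≠ u := fun h => hwu (Subtype.ext h ▸ .refl _)
  have hpwu : (C.labelGraph p).Adj w u :=
    (adj_or_adj_of_not_hasRainbowTriangle hC hpm hne hwv huv.symm).resolve_right fun h =>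
      hwu (Adj.reachable h)
  exact (adj_of_reachable_induce hC hyu.symm (fun h => hwu h.symm) hpwu.symm).symm

/-- If removing `v` disconnects color `m`, then an edge of another color `p` from `w` to `v`
forces the color `p` between `w` and all other components of color `m`. -/
theorem eq_of_adj_of_not_preconnected_induce (hC : ¬ HasRainbowTriangle C) {m p q : K} {v w w' : V}
    (hm : (C.labelGraph m).Preconnected)
    (hmv : ¬ ((C.labelGraph m).induce {v}ᶜ).Preconnected) (hpm : p ≠ m) (hqm : q ≠ m)
    (hp : (C.labelGraph p).Adj w v) (hq : (C.labelGraph q).Adj w' v) : p = q := by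
  lift w to ({v}ᶜ : Set V) using hp.ne
  lift w' to ({v}ᶜ : Set V) using hq.ne
  by_cases hww' : ((C.labelGraph m).induce {v}ᶜ).Reachable w w'
  · obtain ⟨y, hwy⟩ : ∃ y, ¬ ((C.labelGraph m).induce {v}ᶜ).Reachable w y := by
      by_contra! h
      exact hmv fun s t => (h s).symm.trans (h t)
    have hpwy := adj_of_not_reachable_induce_compl_singleton hC hm hpm hp hwy
    exact labelGraph_adj_unique (adj_of_reachable_induce hC hww' hwy hpwy)
      (adj_of_not_reachable_induce_compl_singleton hC hm hqm hq fun h => hwy (hww'.trans h))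
  · exact labelGraph_adj_unique (adj_of_not_reachable_induce_compl_singleton hC hm hpm hp hww')
      (adj_of_not_reachable_induce_compl_singleton hC hm hqm hq fun h => hww' h.symm).symm

/-- Induction on the order: deleting a vertex `v` disconnects one of three such colors, and then all
edges at `v` in other colors have the same color. -/
theorem card_le_two_of_preconnected [Finite V] [Nontrivial V] (hC : ¬ HasRainbowTriangle C)
    {s : Finset K} (hs : ∀ a ∈ s, (C.labelGraph a).Preconnected) : s.card ≤ 2 := by
  classical
  induction hV : Nat.card V using Nat.strong_induction_on generalizing V with
  | _ n ih =>
    by_contra! hcard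
    obtain ⟨v⟩ : Nonempty V := inferInstance
    have hadj : ∀ a ∈ s, ∃ w, (C.labelGraph a).Adj w v := fun a ha =>
      ((hs a ha).exists_adj_of_nontrivial v).imp fun _ h => h.symm
    have : Nontrivial ({v}ᶜ : Set V) := by
      obtain ⟨a, ha, b, hb, hab⟩ := Finset.one_lt_card.1 (one_lt_two.trans hcard)
      obtain ⟨x, hx⟩ := hadj a ha
      obtain ⟨y, hy⟩ := hadj b hb
      refine ⟨⟨x, hx.ne⟩, ⟨y, hy.ne⟩, fun h => hab ?_⟩
      obtain rfl : x = y := congrArg Subtype.val h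
      exact labelGraph_adj_unique hx hy
    obtain ⟨m, hm, hmv⟩ : ∃ m ∈ s, ¬ ((C.labelGraph m).induce {v}ᶜ).Preconnected := by
      by_contra! h
      refine hcard.not_ge (ih _ ?_ (C := restrict C {v}ᶜ) (mt HasRainbowTriangle.of_pullback hC)
        (fun a ha => (labelGraph_restrict C _ a).symm ▸ h a ha) rfl)
      rw [← hV]
      exact Finite.card_subtype_lt (x := v) (by simp)
    obtain ⟨p, hp, q, hq, hpq⟩ := Finset.one_lt_card.1
      ((Nat.lt_sub_of_add_lt hcard).trans_eq (Finset.card_erase_of_mem hm).symm)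
    obtain ⟨w, hw⟩ := hadj p (Finset.mem_of_mem_erase hp)
    obtain ⟨w', hw'⟩ := hadj q (Finset.mem_of_mem_erase hq)
    exact hpq (eq_of_adj_of_not_preconnected_induce hC (hs m hm) hmv (Finset.ne_of_mem_erase hp)
      (Finset.ne_of_mem_erase hq) hw hw')

/-- The vertices of each class of `s` look alike from outside the class. -/
def IsHomogeneous (C : TopEdgeLabeling V K) (s : Setoid V) : Prop :=
  ∀ ⦃b x x' y⦄, s x x' → ¬ s x y → (C.labelGraph b).Adj x y → (C.labelGraph b).Adj x' y

/-- The coloring of the classes of `s` that is read off from chosen representatives; the choice is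
immaterial if `s` is homogeneous. -/
noncomputable def quotientColoring (C : TopEdgeLabeling V K) (s : Setoid V) :
    TopEdgeLabeling (Quotient s) K :=
  TopEdgeLabeling.pullback C ⟨Quotient.out, Quotient.out_injective⟩

theorem IsHomogeneous.quotientColoring_adj_iff {s : Setoid V} (hs : IsHomogeneous C s) {b : K}
    {x y : V} (hxy : ¬ s x y) :
    ((quotientColoring C s).labelGraph b).Adj (Quotient.mk s x) (Quotient.mk s y) ↔
      (C.labelGraph b).Adj x y := by
  have key : ∀ {x x' y y' : V}, s x x' → s y y' → ¬ s x y → (C.labelGraph b).Adj x y →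
      (C.labelGraph b).Adj x' y' := fun hx hy hxy h =>
    (hs hy (fun hyx => hxy (s.trans hx (s.symm hyx))) (hs hx hxy h).symm).symm
  have hx : s (Quotient.mk s x).out x := Quotient.mk_out x
  have hy : s (Quotient.mk s y).out y := Quotient.mk_out y
  rw [quotientColoring, labelGraph_pullback, comap_adj]
  exact ⟨key hx hy fun h => hxy (s.trans (s.symm hx) (s.trans h hy)),
    key (s.symm hx) (s.symm hy) hxy⟩

theorem IsHomogeneous.comap_mk {s : Setoid V} (hs : IsHomogeneous C s) {t : Setoid (Quotient s)}
    (ht : IsHomogeneous (quotientColoring C s) t) :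
    IsHomogeneous C (t.comap (Quotient.mk s)) := by
  intro b x x' y hxx' hxy h
  rw [Setoid.comap_rel] at hxx' hxy
  have hst : ∀ {x y}, ¬ t (Quotient.mk s x) (Quotient.mk s y) → ¬ s x y := fun h hs =>
    h (Quotient.sound hs ▸ t.refl _)
  have hx'y : ¬ t (Quotient.mk s x') (Quotient.mk s y) := fun h => hxy (t.trans hxx' h)
  exact (hs.quotientColoring_adj_iff (hst hx'y)).1
    (ht hxx' hxy ((hs.quotientColoring_adj_iff (hst hxy)).2 h))

/-- A Gallai partition: a partition into at least two homogeneous classes with only the two colors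
`a` and `b`, possibly equal, between the classes. -/
structure IsGallaiPartition (C : TopEdgeLabeling V K) (s : Setoid V) (a b : K) : Prop where
  exists_not_rel : ∃ x y, ¬ s x y
  homogeneous : IsHomogeneous C s
  adj_or_adj : ∀ ⦃x y⦄, ¬ s x y → (C.labelGraph a).Adj x y ∨ (C.labelGraph b).Adj x y

theorem exists_isGallaiPartition_bot [Nontrivial V]
    (hC : ∀ s : Finset K, (∀ a ∈ s, C.labelGraph a ≠ ⊥) → s.card ≤ 2) :
    ∃ a b, IsGallaiPartition C ⊥ a b := by
  classical
  obtain ⟨x, y, hxy⟩ := exists_pair_ne V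
  have hhom : IsHomogeneous C ⊥ := by rintro b x x' y rfl _ h; exact h
  obtain ⟨a, ha⟩ := exists_labelGraph_adj C hxy
  by_cases hb : ∃ b ≠ a, C.labelGraph b ≠ ⊥
  · obtain ⟨b, hba, hb⟩ := hb
    refine ⟨a, b, ⟨x, y, hxy⟩, hhom, fun x y h => ?_⟩
    obtain ⟨c, hc⟩ := exists_labelGraph_adj C h
    by_contra! hcon
    have hca : c ≠ a := by rintro rfl; exact hcon.1 hc
    have hcb : c ≠ b := by rintro rfl; exact hcon.2 hc
    refine (hC {a, b, c} ?_).not_gt (by simp [hba.symm, hca.symm, hcb.symm])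
    simp only [Finset.mem_insert, Finset.mem_singleton, forall_eq_or_imp, forall_eq]
    exact ⟨ne_bot_iff_exists_adj.2 ⟨_, _, ha⟩, hb, ne_bot_iff_exists_adj.2 ⟨_, _, hc⟩⟩
  · push Not at hb
    refine ⟨a, a, ⟨x, y, hxy⟩, hhom, fun x y h => ?_⟩
    obtain ⟨c, hc⟩ := exists_labelGraph_adj C h
    have hca : c = a := by_contra fun hca => (hb c hca ▸ hc : (⊥ : SimpleGraph V).Adj x y)
    exact .inl (hca ▸ hc)

theorem exists_isGallaiPartition [Finite V] [Nontrivial V] (hC : ¬ HasRainbowTriangle C) :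
    ∃ s a b, IsGallaiPartition C s a b := by
  induction hV : Nat.card V using Nat.strong_induction_on generalizing V with
  | _ n ih =>
    by_cases h2 : ∀ P : Finset K, (∀ a ∈ P, C.labelGraph a ≠ ⊥) → P.card ≤ 2
    · exact ⟨⊥, exists_isGallaiPartition_bot h2⟩
    push Not at h2
    obtain ⟨P, hP, hPcard⟩ := h2
    obtain ⟨m, hmP, hm⟩ : ∃ m ∈ P, ¬ (C.labelGraph m).Preconnected := by
      by_contra! h
      exact hPcard.not_ge (card_le_two_of_preconnected hC h)
    let s := (C.labelGraph m).reachableSetoid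
    have hs : IsHomogeneous C s := fun _ _ _ _ => adj_of_reachable hC
    have : Nontrivial (Quotient s) := by
      rw [Preconnected] at hm
      push Not at hm
      obtain ⟨x, y, hxy⟩ := hm
      exact ⟨Quotient.mk s x, Quotient.mk s y, fun h => hxy (Quotient.exact h)⟩
    have hcard : Nat.card (Quotient s) < n := by
      obtain ⟨x, y, hxy⟩ := ne_bot_iff_exists_adj.1 (hP m hmP)
      rw [← hV]
      by_contra! hle
      have hinj := ((Quotient.mk_surjective (s := s)).bijective_of_nat_card_le hle).injective
      exact hxy.ne (hinj (Quotient.sound hxy.reachable))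
    obtain ⟨t, a, b, ⟨q, r, hqr⟩, hthom, htab⟩ :=
      ih _ hcard (C := quotientColoring C s) (mt HasRainbowTriangle.of_pullback hC) rfl
    refine ⟨t.comap (Quotient.mk s), a, b, ⟨q.out, r.out, ?_⟩, hs.comap_mk hthom, ?_⟩
    · rwa [Setoid.comap_rel, Quotient.out_eq, Quotient.out_eq]
    · intro x y hxy
      rw [Setoid.comap_rel] at hxy
      have hsxy : ¬ s x y := fun h => hxy (Quotient.sound h ▸ t.refl _)
      exact (htab hxy).imp (hs.quotientColoring_adj_iff hsxy).1 (hs.quotientColoring_adj_iff hsxy).1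

/-! ### The upper bound -/

theorem card_le_five_of_cliqueFree_three {α : Type*} [Fintype α] {G : SimpleGraph α}
    (hG : G.CliqueFree 3) (hGc : Gᶜ.CliqueFree 3) : Fintype.card α ≤ 5 := by
  classical
  have degree_le_two : ∀ {H : SimpleGraph α}, H.CliqueFree 3 → Hᶜ.CliqueFree 3 → ∀ v,
      H.degree v ≤ 2 := by
    intro H hH hHc v
    by_contra! h
    have : IsIndepSet H (H.neighborSet v) := isIndepSet_neighborSet_of_triangleFree H hH v
    rw [← isClique_compl, ← coe_neighborFinset] at this
    exact hHc.mono h _ ⟨this, card_neighborFinset_eq_degree ..⟩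
  rcases isEmpty_or_nonempty α with _ | ⟨⟨v⟩⟩
  · simp
  have h := degree_le_two hG hGc v
  have hc := degree_le_two hGc (by rwa [compl_compl]) v
  rw [degree_compl] at hc
  omega

theorem IsGallaiPartition.card_quotient_le_five [Finite V] {s : Setoid V} {a b : K}
    (h : IsGallaiPartition C s a b) (hC : ∀ c, (C.labelGraph c).CliqueFree 3) :
    Nat.card (Quotient s) ≤ 5 := by
  have := Fintype.ofFinite (Quotient s)
  have hQ : ∀ c, ((quotientColoring C s).labelGraph c).CliqueFree 3 := fun c => by
    rw [quotientColoring, labelGraph_pullback]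
    exact (hC c).comap (Embedding.comap _ _).isContained
  have hcompl : ((quotientColoring C s).labelGraph a)ᶜ ≤ (quotientColoring C s).labelGraph b := by
    intro q r hqr
    induction q using Quotient.inductionOn
    induction r using Quotient.inductionOn
    rw [compl_adj] at hqr
    have hs := fun hs => hqr.1 (Quotient.sound hs)
    rw [h.homogeneous.quotientColoring_adj_iff hs] at hqr ⊢
    exact (h.adj_or_adj hs).resolve_left hqr.2
  rw [Nat.card_eq_fintype_card]
  exact card_le_five_of_cliqueFree_three (hQ a) ((hQ b).anti hcompl)

theorem exists_cut_or_exists_setoid [Finite V] [Nontrivial V] (hr : ¬ HasRainbowTriangle C)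
    (hm : ∀ c, (C.labelGraph c).CliqueFree 3) :
    (∃ e, ∃ X : Set V, X.Nonempty ∧ Xᶜ.Nonempty ∧ ∀ x ∈ X, ∀ y ∈ Xᶜ, (C.labelGraph e).Adj x y) ∨
      ∃ a b, a ≠ b ∧ ∃ s : Setoid V, Nat.card (Quotient s) ≤ 5 ∧
        ∀ x, (∃ y, ∀ z, s x z → (C.labelGraph a).Adj z y) ∧
          ∃ y, ∀ z, s x z → (C.labelGraph b).Adj z y := by
  obtain ⟨s, a, b, h⟩ := exists_isGallaiPartition hr
  by_cases hone : ∃ e x, ∀ y, ¬ s x y → (C.labelGraph e).Adj x y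
  · obtain ⟨e, x, hx⟩ := hone
    obtain ⟨u, v, huv⟩ := h.exists_not_rel
    refine .inl ⟨e, {z | s x z}, ⟨x, s.refl x⟩, ?_, fun z hz y hy => h.homogeneous hz hy (hx y hy)⟩
    by_contra! hX
    rw [Set.compl_empty_iff] at hX
    have hs : ∀ z, s x z := Set.eq_univ_iff_forall.1 hX
    exact huv (s.trans (s.symm (hs u)) (hs v))
  · push Not at hone
    refine .inr ⟨a, b, ?_, s, h.card_quotient_le_five hm, fun x => ⟨?_, ?_⟩⟩
    · rintro rfl
      obtain ⟨x, -⟩ := h.exists_not_rel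
      obtain ⟨y, hxy, hy⟩ := hone a x
      exact (h.adj_or_adj hxy).elim hy hy
    · obtain ⟨y, hxy, hy⟩ := hone b x
      exact ⟨y, fun z hz => h.homogeneous hz hxy ((h.adj_or_adj hxy).resolve_right hy)⟩
    · obtain ⟨y, hxy, hy⟩ := hone a x
      exact ⟨y, fun z hz => h.homogeneous hz hxy ((h.adj_or_adj hxy).resolve_left hy)⟩

/-- The largest order of a complete graph with an edge-coloring in `k` colors that has neither
monochromatic nor rainbow triangles: `5 ^ (k / 2)` for even `k` and `2 * 5 ^ ((k - 1) / 2)` for odd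
`k`. -/
def maxOrder (k : ℕ) : ℕ := (k % 2 + 1) * 5 ^ (k / 2)

theorem maxOrder_add_two (k : ℕ) : maxOrder (k + 2) = 5 * maxOrder k := by
  rw [maxOrder, maxOrder, Nat.add_mod_right, Nat.add_div_right k two_pos]
  ring

theorem add_one_le_maxOrder (k : ℕ) : k + 1 ≤ maxOrder k := by
  induction k using Nat.twoStepInduction with
  | zero => decide
  | one => decide
  | more k ih _ => rw [maxOrder_add_two]; lia

theorem two_mul_maxOrder_le (k : ℕ) : 2 * maxOrder k ≤ maxOrder (k + 1) := by
  induction k using Nat.twoStepInduction with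
  | zero => decide
  | one => decide
  | more k ih _ => rw [maxOrder_add_two, maxOrder_add_two (k + 1)]; lia

theorem card_le_card_quotient_mul {α : Type*} [Finite α] (s : Setoid α) {n : ℕ}
    (hn : ∀ x, Nat.card {y | s x y} ≤ n) : Nat.card α ≤ Nat.card (Quotient s) * n := by
  have := Fintype.ofFinite (Quotient s)
  have hfiber (q : Quotient s) : Nat.card {y // Quotient.mk s y = q} ≤ n := by
    induction q using Quotient.inductionOn with | _ x
    refine (hn x).trans' (le_of_eq (Nat.card_congr (Equiv.subtypeEquivRight fun y => ?_)))
    exact Quotient.eq.trans s.comm'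
  rw [← Nat.card_congr (Equiv.sigmaFiberEquiv (Quotient.mk s)), Nat.card_sigma,
    Nat.card_eq_fintype_card (α := Quotient s)]
  exact Finset.sum_le_card_nsmul _ _ _ fun q _ => hfiber q

/-- An edge-coloring without monochromatic and rainbow triangles, all of whose colors lie in `P`. -/
structure IsMixedColoring (C : TopEdgeLabeling V K) (P : Finset K) : Prop where
  not_hasRainbowTriangle : ¬ HasRainbowTriangle C
  cliqueFree : ∀ c, (C.labelGraph c).CliqueFree 3
  mem : ∀ {c x y}, (C.labelGraph c).Adj x y → c ∈ P

theorem IsMixedColoring.restrict {P Q : Finset K} (h : IsMixedColoring C P) {X : Set V}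
    (hX : ∀ c ∈ P, c ∉ Q → ∃ y, ∀ x ∈ X, (C.labelGraph c).Adj x y) :
    IsMixedColoring (restrict C X) Q where
  not_hasRainbowTriangle := mt HasRainbowTriangle.of_pullback h.not_hasRainbowTriangle
  cliqueFree c := by
    rw [labelGraph_restrict]
    exact (h.cliqueFree c).comap (Embedding.induce X).isContained
  mem {c u v} huv := by
    classical
    rw [labelGraph_restrict] at huv
    by_contra hc
    obtain ⟨y, hy⟩ := hX c (h.mem huv) hc
    exact h.cliqueFree c _ (is3Clique_iff.2 ⟨u, v, y, huv, hy u u.2, hy v v.2, rfl⟩)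

theorem IsMixedColoring.card_le_maxOrder [Finite V] {P : Finset K} (h : IsMixedColoring C P) :
    Nat.card V ≤ maxOrder P.card := by
  classical
  induction P using Finset.strongInduction generalizing V with
  | _ P ih =>
    rcases subsingleton_or_nontrivial V with _ | _
    · exact (Finite.card_le_one_iff_subsingleton.2 ‹_›).trans
        ((Nat.le_add_left 1 _).trans (add_one_le_maxOrder _))
    rcases exists_cut_or_exists_setoid h.not_hasRainbowTriangle h.cliqueFree with
      ⟨e, X, ⟨x, hx⟩, ⟨y, hy⟩, hXe⟩ | ⟨a, b, hab, s, hs, hsab⟩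
    · have he : e ∈ P := h.mem (hXe x hx y hy)
      have hside {Y : Set V} {z : V} (hz : ∀ w ∈ Y, (C.labelGraph e).Adj w z) :
          Nat.card Y ≤ maxOrder (P.erase e).card :=
        ih _ (Finset.erase_ssubset he) (h.restrict fun c hc hce =>
          (by grind : c = e) ▸ ⟨z, hz⟩)
      have hX := hside fun w hw => hXe w hw y hy
      have hXc := hside fun w hw => (hXe x hx w hw).symm
      have hsum : Nat.card X + Nat.card ↑Xᶜ = Nat.card V := Set.ncard_add_ncard_compl X
      have hle := two_mul_maxOrder_le (P.erase e).card
      rw [Finset.card_erase_add_one he] at hle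
      lia
    · obtain ⟨x⟩ : Nonempty V := inferInstance
      have ha : a ∈ P := (hsab x).1.elim fun y hy => h.mem (hy x (s.refl x))
      have hb : b ∈ P.erase a := Finset.mem_erase.2
        ⟨hab.symm, (hsab x).2.elim fun y hy => h.mem (hy x (s.refl x))⟩
      have hclass (x : V) : Nat.card {y | s x y} ≤ maxOrder ((P.erase a).erase b).card :=
        ih _ ((Finset.erase_ssubset hb).trans (Finset.erase_ssubset ha)) <| by
          refine h.restrict fun c hc hcab => ?_
          obtain rfl | rfl : c = a ∨ c = b := by grind
          exacts [(hsab x).1, (hsab x).2]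
      calc Nat.card V ≤ Nat.card (Quotient s) * maxOrder ((P.erase a).erase b).card :=
            card_le_card_quotient_mul s hclass
        _ ≤ 5 * maxOrder ((P.erase a).erase b).card := Nat.mul_le_mul_right _ hs
        _ = maxOrder P.card := by
            rw [← maxOrder_add_two, ← Finset.card_erase_add_one ha, ← Finset.card_erase_add_one hb]

theorem MixedColorable.le_maxOrder {k N : ℕ} (h : MixedColorable k N) : N ≤ maxOrder k := by
  obtain ⟨C, -, hm, hr⟩ := h
  rw [hasMono_completeGraph_iff] at hm
  push Not at hm
  have hC : IsMixedColoring C Finset.univ := ⟨hr, hm, fun _ => Finset.mem_univ _⟩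
  simpa using hC.card_le_maxOrder

/-! ### Extremal colorings -/

open Classical in
/-- The coloring that arises from `C` by substituting a copy of `D`, in new colors, for every
vertex. -/
noncomputable def substitution (C : TopEdgeLabeling V K) (D : TopEdgeLabeling W L) :
    TopEdgeLabeling (V × W) (K ⊕ L) :=
  EdgeLabeling.mk (fun p q h =>
      if hpq : p.1 = q.1 then .inr (D.get p.2 q.2 fun hpq' => h (Prod.ext hpq hpq'))
      else .inl (C.get p.1 q.1 hpq)) fun p q h => by
    by_cases hpq : p.1 = q.1
    · rw [dif_pos hpq, dif_pos hpq.symm, EdgeLabeling.get_comm]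
    · rw [dif_neg hpq, dif_neg (Ne.symm hpq), EdgeLabeling.get_comm]

theorem labelGraph_substitution_inl (C : TopEdgeLabeling V K) (D : TopEdgeLabeling W L) (a : K) :
    (substitution C D).labelGraph (.inl a) = (C.labelGraph a).comap Prod.fst := by
  ext p q
  rw [comap_adj, TopEdgeLabeling.labelGraph_adj, TopEdgeLabeling.labelGraph_adj]
  simp only [substitution, EdgeLabeling.get_mk]
  by_cases hpq : p.1 = q.1
  · simp [hpq]
  · simp [hpq, ne_of_apply_ne Prod.fst hpq]

theorem substitution_adj_inr {b : L} {p q : V × W} :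
    ((substitution C D).labelGraph (.inr b)).Adj p q ↔
      p.1 = q.1 ∧ (D.labelGraph b).Adj p.2 q.2 := by
  rw [TopEdgeLabeling.labelGraph_adj, TopEdgeLabeling.labelGraph_adj]
  simp only [substitution, EdgeLabeling.get_mk]
  by_cases hpq : p.1 = q.1
  · simp [hpq, Prod.ext_iff]
  · simp [hpq]

theorem HasRainbowTriangle.of_substitution (h : HasRainbowTriangle (substitution C D)) :
    HasRainbowTriangle C ∨ HasRainbowTriangle D := by
  simp only [hasRainbowTriangle_iff] at h ⊢
  obtain ⟨x, y, z, a | a, b | b, c | c, hxy, hyz, hxz, hab, hbc, hac⟩ := h <;>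
    simp only [labelGraph_substitution_inl, comap_adj, substitution_adj_inr] at hxy hyz hxz
  · exact .inl ⟨_, _, _, a, b, c, hxy, hyz, hxz, ne_of_apply_ne _ hab, ne_of_apply_ne _ hbc,
      ne_of_apply_ne _ hac⟩
  · exact absurd (congrArg _ (labelGraph_adj_unique hxy (hxz.1 ▸ hyz.symm))) hab
  · exact absurd (congrArg _ (labelGraph_adj_unique hxy (hyz.1 ▸ hxz))) hac
  · exact absurd (hxz.1.trans hyz.1.symm) hxy.ne
  · exact absurd (congrArg _ (labelGraph_adj_unique hyz (hxy.1 ▸ hxz))) hbc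
  · exact absurd (hxy.1.symm.trans hxz.1) hyz.ne
  · exact absurd (hxy.1.trans hyz.1) hxz.ne
  · exact .inr ⟨_, _, _, a, b, c, hxy.2, hyz.2, hxz.2, ne_of_apply_ne _ hab, ne_of_apply_ne _ hbc,
      ne_of_apply_ne _ hac⟩

theorem HasMono.of_substitution {U : Type} {H : SimpleGraph U} (hH : H.Preconnected)
    (h : HasMono (substitution C D) H) :
    (∃ a, Nonempty (H →g C.labelGraph a)) ∨ HasMono D H := by
  obtain ⟨a | b, ⟨f⟩⟩ := h
  · rw [labelGraph_substitution_inl] at f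
    exact .inl ⟨a, ⟨(Hom.comap _ _).comp f.toHom⟩⟩
  · have hf {u v : U} (huv : H.Adj u v) := substitution_adj_inr.1 (f.toHom.map_adj huv)
    have fst_eq (u v : U) : (f u).1 = (f v).1 := by
      obtain ⟨p⟩ := hH u v
      induction p with
      | nil => rfl
      | cons huv _ ih => exact (hf huv).1.trans ih
    exact .inr ⟨b, ⟨⟨⟨fun u => (f u).2, fun huv => (hf huv).2⟩, fun u v huv =>
      f.injective (Prod.ext (fst_eq u v) huv)⟩⟩⟩

/-- A coloring without monochromatic and rainbow triangles in which every color occurs at every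
vertex. The latter condition allows passing to few vertices without losing colors. -/
structure IsFullMixedColoring (C : TopEdgeLabeling V K) : Prop where
  exists_adj : ∀ x a, ∃ y, (C.labelGraph a).Adj x y
  not_hasMono : ¬ HasMono C (completeGraph (Fin 3))
  not_hasRainbowTriangle : ¬ HasRainbowTriangle C

theorem IsFullMixedColoring.substitution (hC : IsFullMixedColoring C)
    (hD : IsFullMixedColoring D) : IsFullMixedColoring (substitution C D) where
  exists_adj x
    | .inl a => by
      obtain ⟨y, hy⟩ := hC.exists_adj x.1 a
      exact ⟨(y, x.2), by rwa [labelGraph_substitution_inl]⟩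
    | .inr b => by
      obtain ⟨y, hy⟩ := hD.exists_adj x.2 b
      exact ⟨(x.1, y), substitution_adj_inr.2 ⟨rfl, hy⟩⟩
  not_hasMono h := by
    rcases h.of_substitution preconnected_top with ⟨a, ⟨f⟩⟩ | h
    · exact hC.not_hasMono ⟨a, ⟨⟨f, Hom.injective_of_top_hom f⟩⟩⟩
    · exact hD.not_hasMono h
  not_hasRainbowTriangle h :=
    h.of_substitution.elim hC.not_hasRainbowTriangle hD.not_hasRainbowTriangle

theorem isFullMixedColoring_cycleGraph_five :
    IsFullMixedColoring (cycleGraph 5).toTopEdgeLabeling where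
  exists_adj x a := by
    fin_cases a
    · simp only [Fin.zero_eta, toTopEdgeLabeling_labelGraph_compl]; revert x; decide
    · simp only [Fin.mk_one, toTopEdgeLabeling_labelGraph]; revert x; decide
  not_hasMono := by
    rw [hasMono_completeGraph_iff]
    push Not
    intro a
    fin_cases a
    · simp only [Fin.zero_eta, toTopEdgeLabeling_labelGraph_compl, CliqueFree]; decide
    · simp only [Fin.mk_one, toTopEdgeLabeling_labelGraph, CliqueFree]; decide
  not_hasRainbowTriangle := not_hasRainbowTriangle_of_card_le_two (by simp)

theorem isFullMixedColoring_of_subsingleton [Subsingleton V] [IsEmpty K]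
    (C : TopEdgeLabeling V K) : IsFullMixedColoring C where
  exists_adj _ a := isEmptyElim a
  not_hasMono := fun ⟨a, _⟩ => isEmptyElim a
  not_hasRainbowTriangle := fun ⟨x, y, _, hxy, _⟩ => hxy (Subsingleton.elim x y)

theorem isFullMixedColoring_bool (C : TopEdgeLabeling Bool Unit) : IsFullMixedColoring C where
  exists_adj x a := ⟨!x, (TopEdgeLabeling.labelGraph_adj _ _).2 ⟨by simp, rfl⟩⟩
  not_hasMono h := absurd h.card_le (by simp)
  not_hasRainbowTriangle := not_hasRainbowTriangle_of_card_le_two (by simp)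

theorem exists_isFullMixedColoring (m : ℕ) :
    ∃ (V K : Type) (_ : Fintype V) (_ : Fintype K) (C : TopEdgeLabeling V K),
      IsFullMixedColoring C ∧ Fintype.card V = 5 ^ m ∧ Fintype.card K = 2 * m := by
  induction m with
  | zero =>
    let C : TopEdgeLabeling Unit Empty := EdgeLabeling.mk (fun _ _ h => (h rfl).elim) nofun
    exact ⟨Unit, Empty, inferInstance, inferInstance, C, isFullMixedColoring_of_subsingleton C,
      by simp, by simp⟩
  | succ m ih =>
    obtain ⟨V, K, _, _, C, hC, hV, hK⟩ := ih
    refine ⟨Fin 5 × V, Fin 2 ⊕ K, inferInstance, inferInstance, _,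
      isFullMixedColoring_cycleGraph_five.substitution hC, ?_, ?_⟩
    · rw [Fintype.card_prod, Fintype.card_fin, hV, pow_succ']
    · rw [Fintype.card_sum, Fintype.card_fin, hK]; ring

theorem exists_embedding_adj [Fintype V] [Nonempty V] [Fintype K]
    (hC : ∀ x a, ∃ y, (C.labelGraph a).Adj x y) {N : ℕ} (hN : Fintype.card K < N)
    (hNV : N ≤ Fintype.card V) :
    ∃ f : Fin N ↪ V, ∀ a, ∃ i j, (C.labelGraph a).Adj (f i) (f j) := by
  classical
  obtain ⟨x⟩ := ‹Nonempty V›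
  choose y hy using hC x
  have hcard : (insert x (Finset.univ.image y)).card ≤ N :=
    (Finset.card_insert_le _ _).trans ((Nat.succ_le_succ Finset.card_image_le).trans hN)
  obtain ⟨T, hT, hTN⟩ := Finset.exists_superset_card_eq hcard hNV
  let e := (T.equivFinOfCardEq hTN).symm
  have hx : x ∈ T := hT (Finset.mem_insert_self ..)
  have hyT (a : K) : y a ∈ T :=
    hT (Finset.mem_insert_of_mem (Finset.mem_image_of_mem y (Finset.mem_univ a)))
  refine ⟨e.toEmbedding.trans (Function.Embedding.subtype _), fun a =>
    ⟨e.symm ⟨x, hx⟩, e.symm ⟨y a, hyT a⟩, ?_⟩⟩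
  simpa using hy a

theorem IsFullMixedColoring.mixedPatternColorable {U : Type} {H : SimpleGraph U} [Fintype V]
    [Fintype K] (hC : IsFullMixedColoring C) (hH : ¬ HasMono C H) {k N : ℕ}
    (hK : Fintype.card K = k) (hkN : k < N) (hNV : N ≤ Fintype.card V) :
    MixedPatternColorable H k N := by
  subst hK
  have : Nonempty V := Fintype.card_pos_iff.1 (by lia)
  obtain ⟨f, hf⟩ := exists_embedding_adj hC.exists_adj hkN hNV
  refine ⟨(TopEdgeLabeling.pullback C f).compRight (Fintype.equivFin K), fun c => ?_,
    fun h => hC.not_hasMono h.of_compRight_equiv.of_pullback,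
    fun h => hH h.of_compRight_equiv.of_pullback,
    fun h => hC.not_hasRainbowTriangle h.of_compRight.of_pullback⟩
  obtain ⟨i, j, hij⟩ := hf ((Fintype.equivFin K).symm c)
  rw [← comap_adj, ← labelGraph_pullback, ← labelGraph_compRight_equiv] at hij
  obtain ⟨h, hc⟩ := (EdgeLabeling.labelGraph_adj i j).1 hij
  exact ⟨_, hc⟩

theorem isBipartite_of_hom_bool {α : Type*} {H : SimpleGraph α} {G : SimpleGraph Bool}
    (f : H →g G) : H.IsBipartite :=
  Coloring.colorable ((Hom.ofLE le_top).comp f)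

theorem mixedPatternColorable_of_le_maxOrder {U : Type} [Fintype U] {H : SimpleGraph U} {k N : ℕ}
    (hconn : H.Preconnected) (hH : ¬ H.IsBipartite) (hcard : 5 ^ (k / 2) < Fintype.card U)
    (hkN : k < N) (hN : N ≤ maxOrder k) : MixedPatternColorable H k N := by
  obtain ⟨V, K, _, _, C, hC, hV, hK⟩ := exists_isFullMixedColoring (k / 2)
  have hCH : ¬ HasMono C H := fun h => (hcard.trans_le h.card_le).ne' hV
  rcases k.mod_two_eq_zero_or_one with hk | hk <;> rw [maxOrder, hk] at hN
  · exact hC.mixedPatternColorable hCH (by lia) hkN (by lia)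
  · let D : TopEdgeLabeling Bool Unit := fun _ => ()
    have hDC : ¬ HasMono (substitution D C) H := fun h =>
      (h.of_substitution hconn).elim (fun ⟨_, ⟨f⟩⟩ => hH (isBipartite_of_hom_bool f)) hCH
    refine ((isFullMixedColoring_bool D).substitution hC).mixedPatternColorable hDC ?_ hkN ?_
    · rw [Fintype.card_sum, Fintype.card_unit, hK]; lia
    · rwa [Fintype.card_prod, Fintype.card_bool, hV]

/-! ### Comparison of the two Ramsey numbers -/

theorem MixedPatternColorable.mixedColorable {U : Type} {H : SimpleGraph U} {k N : ℕ}
    (h : MixedPatternColorable H k N) : MixedColorable k N :=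
  let ⟨C, hall, hm, _, hr⟩ := h
  ⟨C, hall, hm, hr⟩

theorem le_five_pow_div_two (k : ℕ) : k ≤ 5 ^ (k / 2) := by
  induction k using Nat.twoStepInduction with
  | zero => decide
  | one => decide
  | more k ih _ =>
    have hpos : 0 < 5 ^ (k / 2) := by positivity
    rw [Nat.add_div_right k two_pos, pow_succ]
    lia

theorem mixedPatternColorable_iff {U : Type} [Fintype U] {H : SimpleGraph U} {k N : ℕ}
    (hconn : H.Preconnected) (hH : ¬ H.IsBipartite) (hcard : 5 ^ (k / 2) < Fintype.card U) :
    MixedPatternColorable H k N ↔ MixedColorable k N := by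
  refine ⟨MixedPatternColorable.mixedColorable, fun h => ?_⟩
  rcases lt_or_ge N (Fintype.card U) with hN | hN
  · obtain ⟨C, hall, hm, hr⟩ := h
    exact ⟨C, hall, hm, fun hH => hN.not_ge (hH.card_le.trans_eq (Fintype.card_fin N)), hr⟩
  · exact mixedPatternColorable_of_le_maxOrder hconn hH hcard
      (((le_five_pow_div_two k).trans_lt hcard).trans_le hN) h.le_maxOrder

theorem mixedSet_nonempty {k N : ℕ} (h : MixedColorable k N) : (mixedSet k).Nonempty := by
  by_contra! hempty
  have hall (n : ℕ) : MixedColorable k (N + n) := by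
    induction n with
    | zero => exact h
    | succ n ih =>
      by_contra hn
      exact Set.eq_empty_iff_forall_notMem.1 hempty (N + n + 1) ⟨Nat.le_add_left 1 _, hn, ih⟩
  exact (hall (maxOrder k + 1)).le_maxOrder.not_gt (by lia)

theorem five_pow_lt_of_real_lt {m n : ℕ} (h : ((5 : ℝ) ^ m - 1) / 2 < n) : 5 ^ m < 2 * n + 1 := by
  rw [div_lt_iff₀ two_pos, sub_lt_iff_lt_add, mul_comm] at h
  exact_mod_cast h

theorem not_isBipartite_cycleGraph_of_odd {n : ℕ} (hn : 2 ≤ n) (hodd : Odd n) :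
    ¬ (cycleGraph n).IsBipartite := by
  rw [IsBipartite, ← chromaticNumber_le_iff_colorable, chromaticNumber_cycleGraph_of_odd n hn hodd]
  decide

end MixedRamsey

theorem mainTheorem8_general {U : Type} [Fintype U] {H : SimpleGraph U} {k : ℕ}
    (hconn : H.Preconnected) (hH : ¬ H.IsBipartite) (hcard : 5 ^ (k / 2) < Fintype.card U) :
    (MixedRamsey.mixedSet k).Nonempty ∧ (MixedRamsey.mixedPatternSet H k).Nonempty ∧
      MixedRamsey.M k H = MixedRamsey.R k := by
  have hset : MixedRamsey.mixedPatternSet H k = MixedRamsey.mixedSet k := by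
    simp only [MixedRamsey.mixedPatternSet, MixedRamsey.mixedSet,
      MixedRamsey.mixedPatternColorable_iff hconn hH hcard]
  have hne : (MixedRamsey.mixedSet k).Nonempty := MixedRamsey.mixedSet_nonempty
    (MixedRamsey.mixedPatternColorable_of_le_maxOrder hconn hH hcard
      (MixedRamsey.add_one_le_maxOrder k) le_rfl).mixedColorable
  exact ⟨hne, hset ▸ hne, congrArg sInf hset⟩

/-- The exponents `(k - 1) / 2` and `k / 2` are divisions of natural numbers, exact under the
respective parity hypothesis. Nonemptiness says that both Ramsey numbers really exist. -/
theorem mainTheorem8 (k n : ℕ) (hk : 2 ≤ k) (hn : 1 ≤ n) :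
    (Odd k → ((5 : ℝ) ^ ((k - 1) / 2) - 1) / 2 < (n : ℝ) →
      (MixedRamsey.mixedSet k).Nonempty ∧
      (MixedRamsey.mixedPatternSet (SimpleGraph.cycleGraph (2 * n + 1)) k).Nonempty ∧
      MixedRamsey.M k (SimpleGraph.cycleGraph (2 * n + 1)) = MixedRamsey.R k) ∧
    (Even k → ((5 : ℝ) ^ (k / 2) - 1) / 2 < (n : ℝ) →
      (MixedRamsey.mixedSet k).Nonempty ∧
      (MixedRamsey.mixedPatternSet (SimpleGraph.cycleGraph (2 * n + 1)) k).Nonempty ∧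
      MixedRamsey.M k (SimpleGraph.cycleGraph (2 * n + 1)) = MixedRamsey.R k) := by
  have hodd : Odd (2 * n + 1) := odd_two_mul_add_one n
  have main (h : ((5 : ℝ) ^ (k / 2) - 1) / 2 < (n : ℝ)) :=
    mainTheorem8_general SimpleGraph.cycleGraph_preconnected
      (MixedRamsey.not_isBipartite_cycleGraph_of_odd (by lia) hodd)
      ((MixedRamsey.five_pow_lt_of_real_lt h).trans_eq (Fintype.card_fin _).symm)
  refine ⟨fun hk_odd h => main ?_, fun _ => main⟩
  rwa [show k / 2 = (k - 1) / 2 by grind]
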